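/- Consider auctions with $n\ge 2$ bidders and $m\ge 1$ items. Write $[m]$ for the set of items. A vector of valuations is $\vec v=(v_1,\dots,v_n)$ with $v_i:2^{[m]}\to\mathbb R$. An allocation $\vec o=(o_0,\dots,o_n)\in\mathcal O$ is a partition of $[m]$ into $n+1$ (possibly empty) bundles, where $o_0$ stays with the seller. A mixed bundling auction with item-specific reserve prices (MBARP) $A$ has parameters $c\ge 0$ and $r=(r_1,\dots,r_m)\in\mathbb R^m$. Put $v_0(b)=\sum_{k\in b}r_k$, and put $\lambda(\vec o)=c$ if some bidder $i\in\{1,\dots,n\}$ has $o_i=[m]$ and $\lambda(\vec o)=0$ otherwise. The auction chooses $$\vec o^*=\operatorname*{argmax}_{\vec o\in\mathcal O}\Big(\sum_{j=0}^n v_j(o_j)+\lambda(\vec o)\Big),$$ bidder $i$ pays $$p_{A,i}(\vec v)=\max_{\vec o\in\mathcal O}\Big(\sum_{j\ne i}v_j(o_j)+\lambda(\vec o)\Big)-\Big(\sum_{j\ne i}v_j(o^*_j)+\lambda(\vec o^*)\Big),$$ where $j$ ranges over $\{0,\dots,n\}\setminus\{i\}$, and the revenue is $rev_A(\vec v)=\sum_{i=1}^n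 p_{A,i}(\vec v)$. Ties in the argmax are broken in favour of the first maximizer in a fixed enumeration of $\mathcal O$. Let $R\subseteq\mathbb R^m$ be a Borel set of admissible reserve price vectors (for example $R=\mathbb R^m$ or $R=[0,\infty)^m$), let $\mathcal A$ be the class of all $n$-bidder, $m$-item MBARPs with $c\ge0$ and $r\in R$, and let $X$ be a set of valuation vectors and $U$ a real number such that $rev_A(\vec v)\in[0,U]$ for all $A\in\mathcal A$ and $\vec v\in X$. **Theorem.** The sample complexity of uniform convergence over $\mathcal A$ is $$N=O\Big(\Big(\frac U\epsilon\Big)^2\Big(m^3\log n\,\log\frac U\epsilon+\log\frac1\delta\Big)\Big).$$ That is, for every $\kappa>1$ there is a constant $C>0$, depending only on $\kappa$, such that for all $n$, $m$, enumerations of $\mathcal O$, $R$, $X$, $U$ as above, and all $\epsilon,\delta\in(0,1)$ with $U/\epsilon\ge\kappa$: for every integer $N\ge C\,(U/\epsilon)^2\,(m^3\log n\,\log(U/\epsilon)+\log(1/\delta))$ and every probability distribution $\mathcal D$ on $X$, if $\vec v^1,\dots,\vec v^N$ are drawn independently from $\mathcal D$, then with probability at least $1-\delta$ $$\Big|\frac1N\sum_{t=1}^N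 rev_A(\vec v^t)-\mathbb E_{\vec v\sim\mathcal D}[rev_A(\vec v)]\Big|\le\epsilon\qquad\text{for all }A\in\mathcal A.$$ -/

import Mathlib

open MeasureTheory

noncomputable section

namespace CombAuction

/-- Vectors of valuation functions of `n` bidders over the bundles of `m` items. -/
abbrev Valuations (n m : ℕ) : Type := Fin n → Finset (Fin m) → ℝ

/-- The `(n + 1) ^ m` allocations: each item goes to one of the agents `0, 1, ..., n`. Agent `0` is
the seller (items given to it are not sold), and agent `i.succ` is bidder `i : Fin n`. -/
abbrev Allocation (n m : ℕ) : Type := Fin m → Fin (n + 1)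

/-- The bundle of items that agent `j` receives in the allocation `o`. -/
def bundle {n m : ℕ} (o : Allocation n m) (j : Fin (n + 1)) : Finset (Fin m) :=
  Finset.univ.filter fun k => o k = j

/-- The parameters of a mixed bundling auction with item-specific reserve prices: the boost
`c ≥ 0` of the grand bundle, and the reserve price of each item. -/
structure MBARP (m : ℕ) where
  c : ℝ
  c_nonneg : 0 ≤ c
  r : Fin m → ℝ

/-- The valuations of all agents. The seller's value for a bundle is the reserve price of the
bundle, which is the sum of the reserve prices of its items. -/
def agentValue {n m : ℕ} (A : MBARP m) (v : Valuations n m) (j : Fin (n + 1))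
    (b : Finset (Fin m)) : ℝ :=
  Fin.cases (∑ k ∈ b, A.r k) (fun i => v i b) j

open Classical in
/-- The allocation boost: `c` if some bidder receives the grand bundle, and `0` otherwise. The
seller is not a bidder here. -/
def boost {n m : ℕ} (A : MBARP m) (o : Allocation n m) : ℝ :=
  if ∃ i : Fin n, bundle o i.succ = Finset.univ then A.c else 0

/-- The boosted social welfare of an allocation. -/
def welfare {n m : ℕ} (A : MBARP m) (v : Valuations n m) (o : Allocation n m) : ℝ :=
  ∑ j : Fin (n + 1), agentValue A v j (bundle o j) + boost A o

/-- The boosted social welfare of an allocation, bidder `i`'s value not being counted. -/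
def welfareWithout {n m : ℕ} (A : MBARP m) (v : Valuations n m) (i : Fin n)
    (o : Allocation n m) : ℝ :=
  ∑ j ∈ Finset.univ.erase i.succ, agentValue A v j (bundle o j) + boost A o

open Classical in
theorem maximizers_nonempty {K : ℕ} {α : Type*} [Nonempty α] (e : Fin K ≃ α) (f : α → ℝ) :
    (Finset.univ.filter fun k : Fin K => ∀ a, f a ≤ f (e k)).Nonempty := by
  have : Finite α := Finite.of_equiv _ e
  obtain ⟨a, ha⟩ := Finite.exists_max f
  exact ⟨e.symm a, by simpa using ha⟩

open Classical in
/-- The maximizer of `f`; ties are broken in favour of the first maximizer in the enumeration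
`e`. -/
def argmax {K : ℕ} {α : Type*} [Nonempty α] (e : Fin K ≃ α) (f : α → ℝ) : α :=
  e ((Finset.univ.filter fun k : Fin K => ∀ a, f a ≤ f (e k)).min' (maximizers_nonempty e f))

variable {n m : ℕ} (e : Fin ((n + 1) ^ m) ≃ Allocation n m)

/-- The allocation chosen by the auction. -/
def allocation (A : MBARP m) (v : Valuations n m) : Allocation n m :=
  argmax e (welfare A v)

/-- The welfare-maximizing allocation when bidder `i` is disregarded. -/
def allocationWithout (A : MBARP m) (v : Valuations n m) (i : Fin n) : Allocation n m :=
  argmax e (welfareWithout A v i)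

/-- The payment of bidder `i`. -/
def payment (A : MBARP m) (v : Valuations n m) (i : Fin n) : ℝ :=
  welfareWithout A v i (allocationWithout e A v i) - welfareWithout A v i (allocation e A v)

/-- The revenue: the sum of the bidders' payments (the seller pays nothing). -/
def revenue (A : MBARP m) (v : Valuations n m) : ℝ :=
  ∑ i : Fin n, payment e A v i

/-- The revenue functions of the `n`-bidder, `m`-item MBARPs with all boosts `c ≥ 0` and all
item-specific reserve prices `(r_1, ..., r_m)` in the set `R`. -/
def revenueClass (R : Set (Fin m → ℝ)) : Set (Valuations n m → ℝ) :=
  {f | ∃ A : MBARP m, A.r ∈ R ∧ f = revenue e A}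

end CombAuction

/-- `N₀` samples suffice for uniform convergence over `F` with accuracy `ε` and confidence `1 - δ`:
whatever the distribution `D` on the domain `X`, for i.i.d. samples of any size `N ≥ N₀`, the event
that some `f ∈ F` has sample average further than `ε` from its expectation has probability at most
`δ`. (As a bound on the outer measure of the failure event, this does not presuppose that the event
is measurable.) -/
def UniformConvergenceAt {Ω : Type*} [MeasurableSpace Ω] (X : Set Ω) (F : Set (Ω → ℝ))
    (ε δ N₀ : ℝ) : Prop :=
  ∀ N : ℕ, N₀ ≤ N → ∀ D : Measure Ω, IsProbabilityMeasure D → (∀ᵐ x ∂D, x ∈ X) →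
    Measure.pi (fun _ : Fin N => D)
      {S | ∃ f ∈ F, ε < |(1 / (N : ℝ)) * ∑ k, f (S k) - ∫ x, f x ∂D|} ≤ ENNReal.ofReal δ

end

/-!
For fixed valuations, every comparison that the auction makes between two allocations is the sign of
an affine function of the `m + 1` parameters `(c, r)`. Once all these signs are fixed, so are the
chosen allocations (ties included), and the revenue is affine in `(c, r)`
(`CombAuction.exists_affine_eq_revenue`). Such a class of functions has few behaviours on a finite
sample: by the Sauer–Shelah lemma, `p` affine functions on a parameter set have at most
`(p + 1) ^ (m + 2)` sign patterns (`ncard_range_signPattern_le`, where linear dependence bounds the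
VC dimension). This is applied first to the comparisons, and then, on each piece, to the tests
whether the revenue is at most `k * η`. It gives a finite `η`-net for the revenue vectors on the
sample (`exists_finset_net`), whose size has logarithm `O(m ^ 2 log n + m log N + m log (U / ε))`.

Uniform convergence follows by symmetrization. The failure probability is at most twice the
probability that the averages over two independent samples differ by more than `ε / 2`
(`measure_deviation_le_two_mul_ghost`). That probability is unchanged when pairs of corresponding
sample points are swapped, so it can be averaged over all `2 ^ N` choices of swaps; for a fixed
double sample, a union bound over the net and the tail bound for random signs
(`card_lt_abs_sum_signs_le`) control the fraction of bad choices. The resulting bound,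
`measure_deviation_le_of_piecewise`, holds for all piecewise finite-dimensional classes.

The averaging step needs the ghost-sample event to be measurable up to a null set. As `R` is only a
Borel set and ties matter, the supremum over the class cannot be replaced by one over a countable
subclass. The event is, however, a projection of a Borel set, hence analytic, and analytic sets are
measurable for the completion of every finite measure (`MeasureTheory.AnalyticSet.nullMeasurableSet`).
-/

/-! ### Analytic sets are universally measurable -/

section Analytic

open Set Filter Topology ENNReal

attribute [local instance] PiNat.metricSpaceNatNat

theorem isCompact_setOf_forall_le (n : ℕ → ℕ) : IsCompact {x : ℕ → ℕ | ∀ i, x i ≤ n i} := by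
  have h : {x : ℕ → ℕ | ∀ i, x i ≤ n i} = Set.pi univ fun i => Iic (n i) := by
    ext x; simp [Pi.le_def]
  rw [h]
  exact isCompact_univ_pi fun i => (Set.finite_Iic (n i)).isCompact

/-- By compactness, an open set that contains the box of sequences bounded by `n` already contains
all sequences whose first `k` terms are so bounded, for some `k`. -/
theorem exists_forall_le_subset_of_isOpen {n : ℕ → ℕ} {V : Set (ℕ → ℕ)} (hV : IsOpen V)
    (hK : {x | ∀ i, x i ≤ n i} ⊆ V) : ∃ k, {x : ℕ → ℕ | ∀ i < k, x i ≤ n i} ⊆ V := by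
  obtain ⟨δ, hδ, hsub⟩ := (isCompact_setOf_forall_le n).exists_thickening_subset_open hV hK
  obtain ⟨k, hk⟩ := exists_pow_lt_of_lt_one hδ (by norm_num : (1 / 2 : ℝ) < 1)
  refine ⟨k, fun x hx => hsub ?_⟩
  rw [Metric.mem_thickening_iff]
  refine ⟨fun i => min (x i) (n i), fun i => min_le_right _ _, lt_of_le_of_lt ?_ hk⟩
  rw [← PiNat.mem_cylinder_iff_dist_le, PiNat.mem_cylinder_iff]
  exact fun i hi => (min_eq_left (hx i hi)).symm

/-- Inner regularity of a finite measure for compact subsets of a continuous image of the Baire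
space. The bounds `n i` are chosen one at a time; each choice loses at most `ε' i` because a measure
is continuous along increasing unions of arbitrary sets. -/
theorem exists_isCompact_image_measure_le {Y : Type*} [TopologicalSpace Y]
    [TopologicalSpace.PseudoMetrizableSpace Y] [MeasurableSpace Y] [BorelSpace Y]
    (μ : Measure Y) [IsFiniteMeasure μ]
    {f : (ℕ → ℕ) → Y} (hf : Continuous f) {ε : ℝ≥0∞} (hε : ε ≠ 0) :
    ∃ K, K ⊆ range f ∧ IsCompact K ∧ μ (range f) ≤ μ K + (ε + ε) := by
  obtain ⟨ε', hε', hsum⟩ := ENNReal.exists_pos_sum_of_countable' hε ℕ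
  have step : ∀ (s : Set (ℕ → ℕ)) (k : ℕ), ∃ j, μ (f '' s) ≤ μ (f '' (s ∩ {x | x k ≤ j})) + ε' k := by
    intro s k
    have hU : f '' s = ⋃ j : ℕ, f '' (s ∩ {x | x k ≤ j}) := by
      rw [← image_iUnion, ← inter_iUnion]
      congr 1
      symm
      rw [inter_eq_left]
      exact fun x _ => mem_iUnion.2 ⟨x k, le_refl (x k)⟩
    have hmono : Monotone fun j : ℕ => f '' (s ∩ {x | x k ≤ j}) := fun a b hab =>
      image_mono (inter_subset_inter_right _ fun x (hx : x k ≤ a) => hx.trans hab)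
    have hM := hmono.measure_iUnion (μ := μ)
    rw [← hU] at hM
    rcases eq_or_ne (μ (f '' s)) 0 with h0 | h0
    · exact ⟨0, by simp [h0]⟩
    have hlt : μ (f '' s) - ε' k < ⨆ j : ℕ, μ (f '' (s ∩ {x | x k ≤ j})) := by
      rw [← hM]
      exact ENNReal.sub_lt_self (measure_ne_top _ _) h0 (hε' k).ne'
    obtain ⟨j, hj⟩ := lt_iSup_iff.1 hlt
    exact ⟨j, tsub_le_iff_right.1 hj.le⟩
  choose J hJ using step
  let S : ℕ → Set (ℕ → ℕ) := fun k => Nat.rec univ (fun k s => s ∩ {x | x k ≤ J s k}) k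
  let n : ℕ → ℕ := fun k => J (S k) k
  have hS : ∀ k, S k = {x | ∀ i < k, x i ≤ n i} := by
    intro k
    induction k with
    | zero => ext x; simp [S]
    | succ k ih =>
      have h1 : S (k + 1) = S k ∩ {x | x k ≤ n k} := rfl
      rw [h1, ih]
      ext x
      simp only [mem_inter_iff, mem_ofPred_eq, Nat.lt_succ_iff_lt_or_eq]
      exact ⟨fun h i hi => hi.elim (h.1 i) (fun h' => h' ▸ h.2),
        fun h => ⟨fun i hi => h i (Or.inl hi), h k (Or.inr rfl)⟩⟩
  have hμ : ∀ k, μ (range f) ≤ μ (f '' S k) + ∑ i ∈ Finset.range k, ε' i := by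
    intro k
    induction k with
    | zero => simp [S]
    | succ k ih =>
      refine ih.trans ?_
      rw [Finset.sum_range_succ, add_comm (∑ i ∈ Finset.range k, ε' i), ← add_assoc]
      gcongr
      exact hJ (S k) k
  refine ⟨f '' {x | ∀ i, x i ≤ n i}, image_subset_range _ _, (isCompact_setOf_forall_le n).image hf, ?_⟩
  obtain ⟨O, hO, hOo, hOμ⟩ :=
    (f '' {x | ∀ i, x i ≤ n i}).exists_isOpen_lt_add (measure_ne_top μ _) hε
  obtain ⟨k, hk⟩ := exists_forall_le_subset_of_isOpen (hOo.preimage hf) (image_subset_iff.1 hO)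
  rw [← hS] at hk
  calc μ (range f) ≤ μ (f '' S k) + ∑ i ∈ Finset.range k, ε' i := hμ k
    _ ≤ μ O + ε := by
        gcongr
        · exact image_subset_iff.2 hk
        · exact (ENNReal.sum_le_tsum _).trans hsum.le
    _ ≤ _ := by rw [← add_assoc]; gcongr

/-- Analytic sets are universally measurable. -/
theorem MeasureTheory.AnalyticSet.nullMeasurableSet {Y : Type*} [TopologicalSpace Y]
    [TopologicalSpace.MetrizableSpace Y] [MeasurableSpace Y] [BorelSpace Y]
    {A : Set Y} (hA : AnalyticSet A) (μ : Measure Y) [IsFiniteMeasure μ] :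
    NullMeasurableSet A μ := by
  rw [AnalyticSet] at hA
  rcases hA with rfl | ⟨f, hf, rfl⟩
  · exact nullMeasurableSet_empty
  have h : ∀ k : ℕ, ∃ K, K ⊆ range f ∧ IsCompact K ∧
      μ (range f) ≤ μ K + ((k : ℝ≥0∞)⁻¹ + (k : ℝ≥0∞)⁻¹) := fun k =>
    exists_isCompact_image_measure_le μ hf (ENNReal.inv_ne_zero.2 (ENNReal.natCast_ne_top k))
  choose K hKsub hK hKμ using h
  have hmeas : MeasurableSet (⋃ k, K k) :=
    MeasurableSet.iUnion fun k => (hK k).isClosed.measurableSet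
  refine hmeas.nullMeasurableSet.congr
    (ae_eq_of_subset_of_measure_ge (iUnion_subset hKsub) ?_ hmeas.nullMeasurableSet
      (measure_ne_top _ _))
  have ht : Tendsto (fun k : ℕ => μ (⋃ k, K k) + ((k : ℝ≥0∞)⁻¹ + (k : ℝ≥0∞)⁻¹)) atTop
      (𝓝 (μ (⋃ k, K k) + (0 + 0))) :=
    tendsto_const_nhds.add
      (ENNReal.tendsto_inv_nat_nhds_zero.add ENNReal.tendsto_inv_nat_nhds_zero)
  rw [add_zero, add_zero] at ht
  refine ge_of_tendsto' ht fun k => (hKμ k).trans ?_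
  gcongr
  exact subset_iUnion K k

/-- Measurable projection. -/
theorem MeasurableSet.nullMeasurableSet_image_snd {P Z : Type*} [MeasurableSpace P]
    [StandardBorelSpace P] [MeasurableSpace Z] [StandardBorelSpace Z] {s : Set (P × Z)}
    (hs : MeasurableSet s) (μ : Measure Z) [IsFiniteMeasure μ] :
    NullMeasurableSet (Prod.snd '' s) μ := by
  let _ := upgradeStandardBorel Z
  exact (hs.analyticSet_image measurable_snd).nullMeasurableSet μ

end Analytic

/-! ### Sign patterns of functions from a finite-dimensional space -/

section SignPattern

open Finset

variable {P ι : Type*}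

open Classical in
/-- The set of those functions of the family `g` that are nonpositive at `θ`. -/
noncomputable def signPattern [Fintype ι] (g : ι → P → ℝ) (θ : P) : Finset ι :=
  univ.filter fun i => g i θ ≤ 0

theorem signPattern_eq_iff [Fintype ι] {g : ι → P → ℝ} {θ θ' : P} :
    signPattern g θ = signPattern g θ' ↔ ∀ i, g i θ ≤ 0 ↔ g i θ' ≤ 0 := by
  simp [signPattern, Finset.ext_iff]

theorem sum_choose_le_succ_pow (p D : ℕ) : ∑ k ∈ Iic D, p.choose k ≤ (p + 1) ^ D := by
  rw [add_pow, ← Nat.range_succ_eq_Iic]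
  refine Finset.sum_le_sum fun k hk => ?_
  have h1 : 1 ≤ D.choose k := Nat.choose_pos (by simpa [Nat.lt_succ_iff] using hk)
  have h2 : p.choose k ≤ p ^ k := Nat.choose_le_pow _ _
  simpa using Nat.mul_le_mul h2 h1

/-- A linear dependence between more functions than the dimension rules out the pattern that is
positive exactly where the coefficient is. -/
theorem card_le_of_forall_exists_signPattern [Fintype ι] [DecidableEq ι] {W : Submodule ℝ (P → ℝ)}
    [FiniteDimensional ℝ W] {g : ι → P → ℝ} (hg : ∀ i, g i ∈ W) {s : Finset ι}
    (hs : ∀ t ⊆ s, ∃ θ, s ∩ signPattern g θ = t) : #s ≤ Module.finrank ℝ W := by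
  by_contra! hlt
  let g' : ι → W := fun i => ⟨g i, hg i⟩
  have hdep : ¬ LinearIndependent ℝ fun i : s => g' i := by
    intro h
    have := h.fintype_card_le_finrank
    rw [Fintype.card_coe] at this
    omega
  obtain ⟨w, hw, i₀, hi₀⟩ := Fintype.not_linearIndependent_iff.1 hdep
  replace hw : ∀ θ, ∑ i, w i * g i θ = 0 := fun θ => by
    have := congrFun (congrArg Subtype.val hw) θ
    simpa [g'] using this
  -- Up to a global sign some coefficient is positive.
  obtain ⟨w, hw, i₀, hi₀⟩ : ∃ w : s → ℝ, (∀ θ, ∑ i, w i * g i θ = 0) ∧ ∃ i, 0 < w i := by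
    rcases lt_or_gt_of_ne hi₀ with h | h
    · refine ⟨-w, fun θ => ?_, i₀, by simpa using h⟩
      rw [← neg_eq_zero, ← Finset.sum_neg_distrib, ← hw θ]
      exact Finset.sum_congr rfl fun i _ => by rw [Pi.neg_apply, neg_mul, neg_neg]
    · exact ⟨w, hw, i₀, h⟩
  obtain ⟨θ, hθ⟩ := hs ((univ.filter fun i : s => w i ≤ 0).map (Function.Embedding.subtype _))
    (by intro i; simp only [mem_map]; rintro ⟨j, -, rfl⟩; exact j.2)
  have hsign : ∀ i : s, g i θ ≤ 0 ↔ w i ≤ 0 := by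
    intro i
    have := Finset.ext_iff.1 hθ i
    simpa [signPattern] using this
  have hpos : 0 < ∑ i, w i * g i θ := by
    refine Finset.sum_pos' (fun i _ => ?_) ⟨i₀, mem_univ _, ?_⟩
    · rcases le_or_gt (w i) 0 with h | h
      · exact mul_nonneg_of_nonpos_of_nonpos h ((hsign i).2 h)
      · exact (mul_pos h (not_le.1 fun h' => h.not_ge ((hsign i).1 h'))).le
    · exact mul_pos hi₀ (not_le.1 fun h' => hi₀.not_ge ((hsign i₀).1 h'))
  exact hpos.ne' (hw θ)

/-- Sauer–Shelah bound for the number of sign patterns. -/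
theorem ncard_range_signPattern_le [Fintype ι] {W : Submodule ℝ (P → ℝ)}
    [FiniteDimensional ℝ W] {g : ι → P → ℝ} (hg : ∀ i, g i ∈ W) :
    (Set.range (signPattern g)).ncard ≤ (Fintype.card ι + 1) ^ Module.finrank ℝ W := by
  classical
  set 𝒜 : Finset (Finset ι) := (Set.toFinite (Set.range (signPattern g))).toFinset with h𝒜
  have hvc : 𝒜.vcDim ≤ Module.finrank ℝ W := by
    refine Finset.sup_le fun s hs => card_le_of_forall_exists_signPattern hg fun t ht => ?_
    obtain ⟨u, hu, hut⟩ := mem_shatterer.1 hs ht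
    obtain ⟨θ, rfl⟩ : u ∈ Set.range (signPattern g) := by simpa [h𝒜] using hu
    exact ⟨θ, hut⟩
  rw [Set.ncard_eq_toFinset_card _ (Set.toFinite _)]
  calc #𝒜 ≤ #𝒜.shatterer := card_le_card_shatterer 𝒜
    _ ≤ ∑ k ∈ Iic 𝒜.vcDim, (Fintype.card ι).choose k := card_shatterer_le_sum_vcDim
    _ ≤ (Fintype.card ι + 1) ^ 𝒜.vcDim := sum_choose_le_succ_pow _ _
    _ ≤ _ := Nat.pow_le_pow_right (Nat.succ_pos _) hvc

/-- Finitely many representatives in `Θ`, one for each sign pattern that occurs in `Θ`. -/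
theorem exists_finset_signPattern_eq [Fintype ι] {W : Submodule ℝ (P → ℝ)}
    [FiniteDimensional ℝ W] {g : ι → P → ℝ} (hg : ∀ i, g i ∈ W) (Θ : Set P) :
    ∃ C : Finset P, ↑C ⊆ Θ ∧ #C ≤ (Fintype.card ι + 1) ^ Module.finrank ℝ W ∧
      ∀ θ ∈ Θ, ∃ θ₀ ∈ C, signPattern g θ = signPattern g θ₀ := by
  obtain ⟨C, hC, hbij⟩ := Set.exists_subset_bijOn Θ (signPattern g)
  have hfin : C.Finite := Set.Finite.of_finite_image (Set.toFinite _) hbij.injOn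
  refine ⟨hfin.toFinset, by simpa using hC, ?_, fun θ hθ => ?_⟩
  · rw [← Set.ncard_eq_toFinset_card C hfin, ← hbij.injOn.ncard_image]
    exact (Set.ncard_le_ncard (Set.image_subset_range _ _) (Set.toFinite _)).trans
      (ncard_range_signPattern_le hg)
  · obtain ⟨θ₀, hθ₀, h⟩ := hbij.surjOn ⟨θ, hθ, rfl⟩
    exact ⟨θ₀, by simpa using hθ₀, h.symm⟩

theorem abs_sub_le_of_threshold_iff {U η x y : ℝ} (hη : 0 < η) (hx : x ∈ Set.Icc 0 U)
    (hy : y ∈ Set.Icc 0 U)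
    (h : ∀ k : Fin (⌈U / η⌉₊ + 1), x ≤ (k : ℕ) * η ↔ y ≤ (k : ℕ) * η) : |x - y| ≤ η := by
  have key : ∀ x y : ℝ, x ∈ Set.Icc 0 U → 0 ≤ y →
      (∀ k : Fin (⌈U / η⌉₊ + 1), x ≤ (k : ℕ) * η ↔ y ≤ (k : ℕ) * η) → y ≤ x + η := by
    intro x y hx hy h
    have hle : ⌈x / η⌉₊ ≤ ⌈U / η⌉₊ := Nat.ceil_mono (by gcongr; exact hx.2)
    have h1 : y ≤ (⌈x / η⌉₊ : ℝ) * η :=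
      (h ⟨⌈x / η⌉₊, Nat.lt_succ_of_le hle⟩).1 ((div_le_iff₀ hη).1 (Nat.le_ceil _))
    have h2 : (⌈x / η⌉₊ : ℝ) < x / η + 1 := Nat.ceil_lt_add_one (div_nonneg hx.1 hη.le)
    calc y ≤ (⌈x / η⌉₊ : ℝ) * η := h1
      _ ≤ (x / η + 1) * η := by gcongr
      _ = x + η := by field_simp
  have h1 := key x y hx hy.1 h
  have h2 := key y x hy hx.1 fun k => (h k).symm
  rw [abs_sub_le_iff]
  constructor <;> linarith

/-- Let the parameters be cut into cells by the sign patterns of `g`, and let each `F t` agree on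
each cell with a member of `W`. Then the patterns of the threshold tests `F t θ ≤ k * η`, taken
cell by cell, give an `η`-net for the vectors `(F t θ)_t`. -/
theorem exists_finset_net [Fintype ι] {T : Type*} [Fintype T] {W : Submodule ℝ (P → ℝ)}
    [FiniteDimensional ℝ W] (hW : (fun _ => 1) ∈ W) {g : ι → P → ℝ} (hg : ∀ i, g i ∈ W)
    (F : T → P → ℝ)
    (hF : ∀ t θ₀, ∃ h ∈ W, ∀ θ, signPattern g θ = signPattern g θ₀ → F t θ = h θ)
    {U η : ℝ} (hη : 0 < η) (hU : ∀ t θ, F t θ ∈ Set.Icc 0 U) :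
    ∃ G : Finset P,
      #G ≤ (Fintype.card ι + 1) ^ Module.finrank ℝ W *
        (Fintype.card T * (⌈U / η⌉₊ + 1) + 1) ^ Module.finrank ℝ W ∧
      ∀ θ, ∃ θ' ∈ G, ∀ t, |F t θ - F t θ'| ≤ η := by
  classical
  choose h hhW hh using hF
  obtain ⟨C, -, hC, hCrep⟩ := exists_finset_signPattern_eq hg Set.univ
  let g' : P → T × Fin (⌈U / η⌉₊ + 1) → P → ℝ := fun θ₀ q => h q.1 θ₀ - (q.2 * η) • fun _ => 1
  have hg' : ∀ θ₀ q, g' θ₀ q ∈ W := fun θ₀ q => W.sub_mem (hhW _ _) (W.smul_mem _ hW)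
  have hcell := fun θ₀ =>
    exists_finset_signPattern_eq (hg' θ₀) {θ | signPattern g θ = signPattern g θ₀}
  choose net hnet hnetcard hnetrep using hcell
  refine ⟨C.biUnion net, ?_, fun θ => ?_⟩
  · refine (Finset.card_biUnion_le_card_mul _ _ _ fun θ₀ _ => ?_).trans
      (Nat.mul_le_mul_right _ hC)
    simpa using hnetcard θ₀
  · obtain ⟨θ₀, hθ₀, hθ⟩ := hCrep θ (Set.mem_univ _)
    obtain ⟨θ', hθ', hθθ'⟩ := hnetrep θ₀ θ hθ
    refine ⟨θ', Finset.mem_biUnion.2 ⟨θ₀, hθ₀, hθ'⟩, fun t => ?_⟩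
    refine abs_sub_le_of_threshold_iff hη (hU t θ) (hU t θ') fun k => ?_
    have := signPattern_eq_iff.1 hθθ' (t, k)
    rw [hh t θ₀ θ hθ, hh t θ₀ θ' (hnet θ₀ hθ')]
    simpa [g'] using this

end SignPattern

/-! ### A tail bound for random signs -/

section Signs

open Finset

theorem sum_exp_signs {N : ℕ} (a : Fin N → ℝ) :
    ∑ τ : Fin N → Bool, Real.exp (∑ t, (if τ t then a t else -a t)) =
      ∏ t, (2 * Real.cosh (a t)) := by
  have h : ∀ t, 2 * Real.cosh (a t) = ∑ b : Bool, Real.exp (if b then a t else -a t) := by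
    intro t
    rw [Fintype.sum_bool, Real.cosh_eq]
    simp only [if_true, Bool.false_eq_true, if_false]
    ring
  simp_rw [h, Real.exp_sum]
  rw [Finset.prod_univ_sum, Fintype.piFinset_univ]

/-- Hoeffding's inequality for random signs, as a count of sign vectors. -/
theorem card_lt_sum_signs_le {N : ℕ} (a : Fin N → ℝ) {U s : ℝ} (hN : 0 < N) (hU : 0 < U)
    (ha : ∀ t, |a t| ≤ U) (hs : 0 < s) :
    (#{τ : Fin N → Bool | s < ∑ t, (if τ t then a t else -a t)} : ℝ) ≤
      2 ^ N * Real.exp (-(s ^ 2 / (2 * N * U ^ 2))) := by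
  have hN' : (0 : ℝ) < N := Nat.cast_pos.2 hN
  -- The exponent `l` minimizes `N * (l * U) ^ 2 / 2 - l * s`.
  set l : ℝ := s / (N * U ^ 2) with hl
  have hlpos : 0 < l := by positivity
  have h1 : (#{τ : Fin N → Bool | s < ∑ t, (if τ t then a t else -a t)} : ℝ) * Real.exp (l * s) ≤
      ∑ τ : Fin N → Bool, Real.exp (∑ t, (if τ t then l * a t else -(l * a t))) := by
    rw [← nsmul_eq_mul]
    refine (Finset.card_nsmul_le_sum _ _ _ fun τ hτ => ?_).trans
      (Finset.sum_le_sum_of_subset_of_nonneg (Finset.subset_univ _)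
        fun _ _ _ => (Real.exp_pos _).le)
    rw [Real.exp_le_exp]
    have : ∑ t, (if τ t then l * a t else -(l * a t)) = l * ∑ t, (if τ t then a t else -a t) := by
      rw [Finset.mul_sum]
      refine Finset.sum_congr rfl fun t _ => ?_
      split_ifs <;> ring
    rw [this]
    exact mul_le_mul_of_nonneg_left (Finset.mem_filter.1 hτ).2.le hlpos.le
  have h2 : ∏ t, (2 * Real.cosh (l * a t)) ≤ 2 ^ N * Real.exp (N * (l ^ 2 * U ^ 2 / 2)) := by
    calc ∏ t, (2 * Real.cosh (l * a t)) ≤ ∏ _t : Fin N, (2 * Real.exp (l ^ 2 * U ^ 2 / 2)) := by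
          refine Finset.prod_le_prod (fun t _ => by positivity) fun t _ => ?_
          refine mul_le_mul_of_nonneg_left ((Real.cosh_le_exp_half_sq _).trans ?_) (by norm_num)
          rw [Real.exp_le_exp, mul_pow, ← sq_abs (a t)]
          gcongr
          exact ha t
      _ = _ := by
          rw [Finset.prod_const, mul_pow, ← Real.exp_nat_mul]
          simp
  rw [sum_exp_signs] at h1
  have h3 := h1.trans h2
  rw [← le_div_iff₀ (Real.exp_pos _), mul_div_assoc, ← Real.exp_sub] at h3
  refine h3.trans (le_of_eq ?_)
  congr 2
  rw [hl]
  field_simp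
  ring

theorem card_lt_abs_sum_signs_le {N : ℕ} (a : Fin N → ℝ) {U s : ℝ} (hN : 0 < N) (hU : 0 < U)
    (ha : ∀ t, |a t| ≤ U) (hs : 0 < s) :
    (#{τ : Fin N → Bool | s < |∑ t, (if τ t then a t else -a t)|} : ℝ) ≤
      2 ^ N * (2 * Real.exp (-(s ^ 2 / (2 * N * U ^ 2)))) := by
  have h1 := card_lt_sum_signs_le a hN hU ha hs
  have h2 := card_lt_sum_signs_le (fun t => -a t) hN hU (fun t => by simpa using ha t) hs
  have h3 : #{τ : Fin N → Bool | s < |∑ t, (if τ t then a t else -a t)|} ≤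
      #{τ : Fin N → Bool | s < ∑ t, (if τ t then a t else -a t)} +
      #{τ : Fin N → Bool | s < ∑ t, (if τ t then -a t else - -a t)} := by
    refine (Finset.card_le_card fun τ hτ => ?_).trans (Finset.card_union_le _ _)
    have hneg : ∑ t, (if τ t then -a t else - -a t) = -∑ t, (if τ t then a t else -a t) := by
      rw [← Finset.sum_neg_distrib]
      refine Finset.sum_congr rfl fun t _ => ?_
      split_ifs <;> ring
    rw [Finset.mem_union, Finset.mem_filter, Finset.mem_filter, hneg]
    simpa [lt_abs] using hτ
  have h4 : (#{τ : Fin N → Bool | s < |∑ t, (if τ t then a t else -a t)|} : ℝ) ≤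
      #{τ : Fin N → Bool | s < ∑ t, (if τ t then a t else -a t)} +
      #{τ : Fin N → Bool | s < ∑ t, (if τ t then -a t else - -a t)} := by exact_mod_cast h3
  linarith

end Signs

/-! ### Symmetrization -/

section Symmetrization

open Set Filter ProbabilityTheory ENNReal

variable {Ω P : Type*} [MeasurableSpace Ω]

/-- Chebyshev's inequality for the sample average of a function with values in `[0, U]`. -/
theorem measure_pi_average_deviation_le_half (D : Measure Ω) [IsProbabilityMeasure D] {f : Ω → ℝ}
    (hf : Measurable f) {U ε : ℝ} (hfU : ∀ᵐ x ∂D, f x ∈ Icc 0 U) (hε : 0 < ε) {N : ℕ} (hN : 0 < N)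
    (hNU : 2 * U ^ 2 ≤ N * ε ^ 2) :
    Measure.pi (fun _ : Fin N => D)
      {S | ε / 2 ≤ |(1 / (N : ℝ)) * ∑ k, f (S k) - ∫ x, f x ∂D|} ≤ 2⁻¹ := by
  have hN' : (0 : ℝ) < N := Nat.cast_pos.2 hN
  have hmem : MemLp f 2 D := memLp_of_bounded hfU hf.aestronglyMeasurable 2
  have hvar : Var[∑ i : Fin N, fun S : Fin N → Ω => f (S i); Measure.pi fun _ => D] =
      N * Var[f; D] := by
    rw [variance_sum_pi (X := fun _ : Fin N => f) fun _ => hmem]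
    simp
  have hmem' : MemLp (∑ i : Fin N, fun S : Fin N → Ω => f (S i)) 2 (Measure.pi fun _ => D) :=
    memLp_finsetSum' _ fun i _ =>
      hmem.comp_measurePreserving (measurePreserving_eval (fun _ : Fin N => D) i)
  have hint : ∫ S, (∑ i : Fin N, fun S : Fin N → Ω => f (S i)) S ∂(Measure.pi fun _ => D) =
      N * ∫ x, f x ∂D := by
    simp only [Finset.sum_apply]
    have hi : ∀ i : Fin N, Integrable (fun S : Fin N → Ω => f (S i)) (Measure.pi fun _ => D) :=
      fun i => (measurePreserving_eval (fun _ : Fin N => D) i).integrable_comp_of_integrable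
        (hmem.integrable (by norm_num))
    rw [integral_finsetSum _ fun i _ => hi i]
    have : ∀ i : Fin N, ∫ S : Fin N → Ω, f (S i) ∂(Measure.pi fun _ => D) = ∫ x, f x ∂D :=
      fun i => integral_comp_eval (μ := fun _ : Fin N => D) (i := i) hf.aestronglyMeasurable
    simp [this]
  have h := meas_ge_le_variance_div_sq hmem' (c := N * ε / 2) (by positivity)
  rw [hint, hvar] at h
  refine (measure_mono fun S hS => ?_).trans (h.trans ?_)
  · rw [mem_ofPred_eq, Finset.sum_apply] at *
    have h1 : ∑ k, f (S k) - N * ∫ x, f x ∂D =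
        N * ((1 / (N : ℝ)) * ∑ k, f (S k) - ∫ x, f x ∂D) := by field_simp
    rw [h1, abs_mul, abs_of_pos hN', mul_div_assoc]
    exact mul_le_mul_of_nonneg_left hS hN'.le
  · have h2 : Var[f; D] ≤ (U / 2) ^ 2 := by
      simpa using variance_le_sq_of_bounded hfU hf.aemeasurable
    rw [← ENNReal.ofReal_ofNat, ← ENNReal.ofReal_inv_of_pos (by norm_num)]
    refine ENNReal.ofReal_le_ofReal ?_
    rw [div_le_iff₀ (by positivity)]
    nlinarith

/-- Comparison with an independent ghost sample. Neither of the two sets need be measurable. -/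
theorem measure_deviation_le_two_mul_ghost (D : Measure Ω) [IsProbabilityMeasure D] (F : P → Ω → ℝ)
    (hF : ∀ θ, Measurable (F θ)) {U ε : ℝ} (hFU : ∀ θ, ∀ᵐ x ∂D, F θ x ∈ Icc 0 U) (hε : 0 < ε)
    {N : ℕ} (hN : 0 < N) (hNU : 2 * U ^ 2 ≤ N * ε ^ 2) :
    Measure.pi (fun _ : Fin N => D)
      {S | ∃ θ, ε < |(1 / (N : ℝ)) * ∑ k, F θ (S k) - ∫ x, F θ x ∂D|} ≤
    2 * Measure.pi (fun _ : Fin N => D.prod D)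
      {z | ∃ θ, N * (ε / 2) < |∑ k, (F θ (z k).1 - F θ (z k).2)|} := by
  have hN' : (0 : ℝ) < N := Nat.cast_pos.2 hN
  set μ := Measure.pi fun _ : Fin N => D with hμ
  set B : Set ((Fin N → Ω) × (Fin N → Ω)) :=
    {z | ∃ θ, N * (ε / 2) < |∑ k, (F θ (z.1 k) - F θ (z.2 k))|} with hB
  have hQ : Measure.pi (fun _ : Fin N => D.prod D)
      {z | ∃ θ, N * (ε / 2) < |∑ k, (F θ (z k).1 - F θ (z k).2)|} = μ.prod μ B :=
    (measurePreserving_arrowProdEquivProdArrow Ω Ω (Fin N) (fun _ => D)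
      fun _ => D).measure_preimage_equiv B
  set M := toMeasurable (μ.prod μ) B with hM
  have hMm : MeasurableSet M := measurableSet_toMeasurable _ _
  have hsub : {S | ∃ θ, ε < |(1 / (N : ℝ)) * ∑ k, F θ (S k) - ∫ x, F θ x ∂D|} ⊆
      {S | 2⁻¹ ≤ μ (Prod.mk S ⁻¹' M)} := by
    rintro S ⟨θ, hθ⟩
    set G : Set (Fin N → Ω) := {S | ε / 2 ≤ |(1 / (N : ℝ)) * ∑ k, F θ (S k) - ∫ x, F θ x ∂D|}
      with hG
    have hGm : MeasurableSet G := by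
      have : ∀ k, Measurable fun S : Fin N → Ω => F θ (S k) := fun k =>
        (hF θ).comp (measurable_pi_apply k)
      exact measurableSet_le measurable_const (by fun_prop)
    have h1 : μ G ≤ 2⁻¹ := measure_pi_average_deviation_le_half D (hF θ) (hFU θ) hε hN hNU
    have h2 : 2⁻¹ ≤ μ Gᶜ := by
      rw [prob_compl_eq_one_sub hGm, ← ENNReal.one_sub_inv_two]
      exact tsub_le_tsub_left h1 _
    refine h2.trans (measure_mono fun S' hS' => subset_toMeasurable _ _ ⟨θ, ?_⟩)
    have hS'' : |(1 / (N : ℝ)) * ∑ k, F θ (S' k) - ∫ x, F θ x ∂D| < ε / 2 := not_le.1 hS'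
    have h3 : ∑ k, (F θ (S k) - F θ (S' k)) = N * (((1 / (N : ℝ)) * ∑ k, F θ (S k) - ∫ x, F θ x ∂D) -
        ((1 / (N : ℝ)) * ∑ k, F θ (S' k) - ∫ x, F θ x ∂D)) := by
      rw [Finset.sum_sub_distrib]
      field_simp
      ring
    change N * (ε / 2) < |∑ k, (F θ (S k) - F θ (S' k))|
    rw [h3, abs_mul, abs_of_pos hN']
    refine mul_lt_mul_of_pos_left ?_ hN'
    have := abs_sub_abs_le_abs_sub ((1 / (N : ℝ)) * ∑ k, F θ (S k) - ∫ x, F θ x ∂D)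
      ((1 / (N : ℝ)) * ∑ k, F θ (S' k) - ∫ x, F θ x ∂D)
    linarith
  rw [hQ, ← measure_toMeasurable B, ← hM, Measure.prod_apply hMm]
  have hmk := mul_meas_ge_le_lintegral (μ := μ) (measurable_measure_prodMk_left hMm (ν := μ)) 2⁻¹
  calc μ _ ≤ μ {S | 2⁻¹ ≤ μ (Prod.mk S ⁻¹' M)} := measure_mono hsub
    _ = 2 * (2⁻¹ * μ {S | 2⁻¹ ≤ μ (Prod.mk S ⁻¹' M)}) := by
        rw [← mul_assoc, ENNReal.mul_inv_cancel (by norm_num) (by norm_num), one_mul]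
    _ ≤ _ := by gcongr

open Classical in
/-- The measure of a set is at most the largest fraction of a finite family of measure-preserving
maps that send a single point into it. -/
theorem measure_le_of_card_preimages_le {Z T : Type*} [MeasurableSpace Z] [Fintype T] [Nonempty T]
    (Q : Measure Z) [IsProbabilityMeasure Q] {φ : T → Z → Z} (hφ : ∀ τ, MeasurePreserving (φ τ) Q Q)
    {B : Set Z} (hB : NullMeasurableSet B Q) {r : ℝ}
    (h : ∀ᵐ z ∂Q, ((Finset.univ.filter fun τ => φ τ z ∈ B).card : ℝ) ≤ Fintype.card T * r) :
    Q B ≤ ENNReal.ofReal r := by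
  have hc : (Fintype.card T : ℝ≥0∞) ≠ 0 := by simp
  have hsum : (Fintype.card T : ℝ≥0∞) * Q B =
      ∫⁻ z, ((Finset.univ.filter fun τ => φ τ z ∈ B).card : ℝ≥0∞) ∂Q := by
    have hnull : ∀ τ, NullMeasurableSet (φ τ ⁻¹' B) Q := fun τ =>
      hB.preimage (hφ τ).quasiMeasurePreserving
    have h1 : ∀ z, ((Finset.univ.filter fun τ => φ τ z ∈ B).card : ℝ≥0∞) =
        ∑ τ, (φ τ ⁻¹' B).indicator (fun _ => 1) z := by
      intro z
      simp [Set.indicator_apply, Finset.sum_boole]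
    simp_rw [h1]
    rw [lintegral_finsetSum' _ fun τ _ => aemeasurable_const.indicator₀ (hnull τ)]
    simp_rw [lintegral_indicator_const₀ (hnull _), one_mul, (hφ _).measure_preimage hB]
    simp
  rw [← ENNReal.mul_le_mul_iff_right hc (ENNReal.natCast_ne_top _), hsum]
  calc _ ≤ ∫⁻ _, (Fintype.card T : ℝ≥0∞) * ENNReal.ofReal r ∂Q := by
        refine lintegral_mono_ae (h.mono fun z hz => ?_)
        rw [← ENNReal.ofReal_natCast, ← ENNReal.ofReal_natCast,
          ← ENNReal.ofReal_mul (Nat.cast_nonneg _)]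
        exact ENNReal.ofReal_le_ofReal hz
    _ = _ := by simp

/-- A uniform deviation bound for a class of functions that, at each sample point, are cut by the
sign patterns of the tests `g` into pieces from the finite-dimensional space `W`. -/
theorem measure_deviation_le_of_piecewise [StandardBorelSpace Ω] [MeasurableSpace P]
    [StandardBorelSpace P] {ι : Type*} [Fintype ι] (F : P → Ω → ℝ)
    (hF : Measurable (Function.uncurry F)) (W : Submodule ℝ (P → ℝ)) [FiniteDimensional ℝ W]
    (hW : (fun _ => 1) ∈ W) (g : Ω → ι → P → ℝ) (hg : ∀ ω i, g ω i ∈ W)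
    (hpiece : ∀ ω θ₀, ∃ h ∈ W, ∀ θ, signPattern (g ω) θ = signPattern (g ω) θ₀ → F θ ω = h θ)
    {X : Set Ω} {U ε : ℝ} (hU : 0 < U) (hFU : ∀ θ, ∀ ω ∈ X, F θ ω ∈ Icc 0 U) (hε : 0 < ε)
    {N : ℕ} (hN : 0 < N) (hNU : 2 * U ^ 2 ≤ N * ε ^ 2)
    (D : Measure Ω) [IsProbabilityMeasure D] (hDX : ∀ᵐ x ∂D, x ∈ X) :
    Measure.pi (fun _ : Fin N => D)
      {S | ∃ θ, ε < |(1 / (N : ℝ)) * ∑ k, F θ (S k) - ∫ x, F θ x ∂D|} ≤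
    2 * ENNReal.ofReal (((N * 2 * Fintype.card ι + 1 : ℕ) : ℝ) ^ Module.finrank ℝ W *
      ((N * 2 * (⌈U / (ε / 8)⌉₊ + 1) + 1 : ℕ) : ℝ) ^ Module.finrank ℝ W *
        (2 * Real.exp (-((N * (ε / 4)) ^ 2 / (2 * N * U ^ 2))))) := by
  classical
  have hFθ : ∀ θ, Measurable (F θ) := fun θ => hF.of_uncurry_left
  refine (measure_deviation_le_two_mul_ghost D F hFθ
    (fun θ => hDX.mono fun x hx => hFU θ x hx) hε hN hNU).trans ?_
  gcongr
  set Q := Measure.pi fun _ : Fin N => D.prod D with hQ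
  have hB : NullMeasurableSet
      {z : Fin N → Ω × Ω | ∃ θ, N * (ε / 2) < |∑ k, (F θ (z k).1 - F θ (z k).2)|} Q := by
    have hm : MeasurableSet {p : P × (Fin N → Ω × Ω) |
        N * (ε / 2) < |∑ k, (F p.1 (p.2 k).1 - F p.1 (p.2 k).2)|} := by
      have h1 : ∀ k, Measurable fun p : P × (Fin N → Ω × Ω) => F p.1 (p.2 k).1 := fun k =>
        hF.comp (measurable_fst.prodMk
          (measurable_fst.comp ((measurable_pi_apply k).comp measurable_snd)))
      have h2 : ∀ k, Measurable fun p : P × (Fin N → Ω × Ω) => F p.1 (p.2 k).2 := fun k =>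
        hF.comp (measurable_fst.prodMk
          (measurable_snd.comp ((measurable_pi_apply k).comp measurable_snd)))
      exact measurableSet_lt measurable_const (by fun_prop)
    convert hm.nullMeasurableSet_image_snd Q using 1
    ext z
    simp
  have hX : ∀ᵐ z ∂Q, ∀ k, (z k).1 ∈ X ∧ (z k).2 ∈ X := by
    refine ae_all_iff.2 fun k => ?_
    have h1 : ∀ᵐ p ∂D.prod D, p.1 ∈ X ∧ p.2 ∈ X :=
      (measurePreserving_fst.quasiMeasurePreserving.ae hDX).and
        (measurePreserving_snd.quasiMeasurePreserving.ae hDX)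
    exact (measurePreserving_eval (fun _ : Fin N => D.prod D) k).quasiMeasurePreserving.ae h1
  refine measure_le_of_card_preimages_le (T := Fin N → Bool) Q
    (φ := fun τ z k => if τ k then z k else (z k).swap) (fun τ => ?_) hB (hX.mono fun z hz => ?_)
  · refine measurePreserving_pi _ _ (f := fun k (p : Ω × Ω) => if τ k then p else p.swap) fun k => ?_
    cases τ k
    · simpa using Measure.measurePreserving_swap
    · simpa using! MeasurePreserving.id (D.prod D)
  -- The double sample, as one family of points.
  let pt : Fin N × Bool → Ω := fun q => if q.2 then (z q.1).1 else (z q.1).2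
  have hpt : ∀ q, pt q ∈ X := fun q => by
    by_cases h : q.2 = true
    · simpa [pt, h] using (hz q.1).1
    · simpa [pt, h] using (hz q.1).2
  obtain ⟨G, hGcard, hG⟩ := exists_finset_net (T := Fin N × Bool)
    (g := fun q : (Fin N × Bool) × ι => g (pt q.1) q.2) hW
    (fun q => hg _ _) (fun q θ => F θ (pt q)) (fun q θ₀ => by
      obtain ⟨h, hhW, hh⟩ := hpiece (pt q) θ₀
      refine ⟨h, hhW, fun θ hθ => hh θ ?_⟩
      rw [signPattern_eq_iff] at hθ ⊢
      exact fun i => hθ (q, i)) (η := ε / 8) (by positivity) (fun q θ => hFU θ _ (hpt q))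
  have hN' : (0 : ℝ) < N := Nat.cast_pos.2 hN
  have hsub : (Finset.univ.filter fun τ : Fin N → Bool =>
      (fun k => if τ k then z k else (z k).swap) ∈
        {z : Fin N → Ω × Ω | ∃ θ, N * (ε / 2) < |∑ k, (F θ (z k).1 - F θ (z k).2)|}) ⊆
      G.biUnion fun θ => Finset.univ.filter fun τ : Fin N → Bool => N * (ε / 4) <
        |∑ k, (if τ k then F θ (z k).1 - F θ (z k).2 else -(F θ (z k).1 - F θ (z k).2))| := by
    intro τ hτ
    obtain ⟨θ, hθ⟩ := (Finset.mem_filter.1 hτ).2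
    obtain ⟨θ', hθ', hclose⟩ := hG θ
    refine Finset.mem_biUnion.2 ⟨θ', hθ', Finset.mem_filter.2 ⟨Finset.mem_univ _, ?_⟩⟩
    have h1 : ∑ k, (F θ (if τ k then z k else (z k).swap).1 -
        F θ (if τ k then z k else (z k).swap).2) =
        ∑ k, (if τ k then F θ (z k).1 - F θ (z k).2 else -(F θ (z k).1 - F θ (z k).2)) := by
      refine Finset.sum_congr rfl fun k _ => ?_
      split_ifs <;> simp
    rw [h1] at hθ
    have h2 : |∑ k, (if τ k then F θ (z k).1 - F θ (z k).2 else -(F θ (z k).1 - F θ (z k).2)) -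
        ∑ k, (if τ k then F θ' (z k).1 - F θ' (z k).2 else -(F θ' (z k).1 - F θ' (z k).2))| ≤
        N * (ε / 4) := by
      rw [← Finset.sum_sub_distrib]
      refine (Finset.abs_sum_le_sum_abs _ _).trans ?_
      refine (Finset.sum_le_card_nsmul _ _ (ε / 4) fun k _ => ?_).trans (by simp)
      have e1 := abs_le.1 (hclose (k, true))
      have e2 := abs_le.1 (hclose (k, false))
      simp only [pt, if_true, Bool.false_eq_true, if_false] at e1 e2
      rw [abs_le]
      split_ifs <;> constructor <;> linarith
    have h3 := abs_sub_abs_le_abs_sub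
      (∑ k, (if τ k then F θ (z k).1 - F θ (z k).2 else -(F θ (z k).1 - F θ (z k).2)))
      (∑ k, (if τ k then F θ' (z k).1 - F θ' (z k).2 else -(F θ' (z k).1 - F θ' (z k).2)))
    linarith
  have hcard : ∀ θ ∈ G, ((Finset.univ.filter fun τ : Fin N → Bool => N * (ε / 4) <
      |∑ k, (if τ k then F θ (z k).1 - F θ (z k).2 else -(F θ (z k).1 - F θ (z k).2))|).card : ℝ) ≤
      2 ^ N * (2 * Real.exp (-((N * (ε / 4)) ^ 2 / (2 * N * U ^ 2)))) := by
    intro θ _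
    refine card_lt_abs_sum_signs_le _ hN hU (fun k => ?_) (by positivity)
    have e1 := hFU θ _ (hz k).1
    have e2 := hFU θ _ (hz k).2
    rw [abs_le]
    constructor <;> linarith [e1.1, e1.2, e2.1, e2.2]
  have hGcard' : (G.card : ℝ) ≤ ((N * 2 * Fintype.card ι + 1 : ℕ) : ℝ) ^ Module.finrank ℝ W *
      ((N * 2 * (⌈U / (ε / 8)⌉₊ + 1) + 1 : ℕ) : ℝ) ^ Module.finrank ℝ W := by
    rw [← Nat.cast_pow, ← Nat.cast_pow, ← Nat.cast_mul, Nat.cast_le]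
    simpa using hGcard
  calc _ ≤ ∑ θ ∈ G, ((Finset.univ.filter fun τ : Fin N → Bool => N * (ε / 4) <
        |∑ k, (if τ k then F θ (z k).1 - F θ (z k).2
          else -(F θ (z k).1 - F θ (z k).2))|).card : ℝ) := by
        exact_mod_cast (Finset.card_le_card hsub).trans Finset.card_biUnion_le
    _ ≤ G.card * (2 ^ N * (2 * Real.exp (-((N * (ε / 4)) ^ 2 / (2 * N * U ^ 2))))) := by
        simpa only [nsmul_eq_mul] using Finset.sum_le_card_nsmul _ _ _ hcard
    _ ≤ (((N * 2 * Fintype.card ι + 1 : ℕ) : ℝ) ^ Module.finrank ℝ W *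
        ((N * 2 * (⌈U / (ε / 8)⌉₊ + 1) + 1 : ℕ) : ℝ) ^ Module.finrank ℝ W) *
          (2 ^ N * (2 * Real.exp (-((N * (ε / 4)) ^ 2 / (2 * N * U ^ 2))))) := by gcongr
    _ = _ := by
        simp only [Fintype.card_fun, Fintype.card_bool, Fintype.card_fin, Nat.cast_pow,
          Nat.cast_ofNat]
        ring

end Symmetrization

/-! ### The revenue as a piecewise affine function of the parameters -/

namespace CombAuction

section Argmax

variable {K : ℕ} {α : Type*} [Nonempty α]

open Classical in
/-- The chosen maximizer depends only on the order that `f` induces, ties included. -/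
theorem argmax_congr (e : Fin K ≃ α) {f f' : α → ℝ} (h : ∀ a b, f a ≤ f b ↔ f' a ≤ f' b) :
    argmax e f = argmax e f' := by
  have hset : (Finset.univ.filter fun k : Fin K => ∀ a, f a ≤ f (e k)) =
      Finset.univ.filter fun k : Fin K => ∀ a, f' a ≤ f' (e k) := by
    ext k
    simp [h]
  simp only [argmax, hset]

theorem measurable_argmax {Z : Type*} [MeasurableSpace Z] [MeasurableSpace α] [Finite α]
    [MeasurableSingletonClass α] (e : Fin K ≃ α) {f : α → Z → ℝ} (hf : ∀ a, Measurable (f a)) :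
    Measurable fun z => argmax e fun a => f a z := by
  classical
  -- The maximizer factors through the finitely many outcomes of all comparisons.
  let pat : Z → α × α → Prop := fun z q => f q.1 z ≤ f q.2 z
  have hpat : Measurable pat := measurable_pi_iff.2 fun q =>
    measurableSet_setOfPred.1 (measurableSet_le (hf q.1) (hf q.2))
  have hfac : ∀ z z', pat z = pat z' → argmax e (fun a => f a z) = argmax e fun a => f a z' :=
    fun z z' h => argmax_congr e fun a b => iff_of_eq (congrFun h (a, b))
  refine measurable_to_countable' fun a => ?_
  have : (fun z => argmax e fun a => f a z) ⁻¹' {a} =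
      pat ⁻¹' (pat '' ((fun z => argmax e fun a => f a z) ⁻¹' {a})) := by
    refine Set.Subset.antisymm (Set.subset_preimage_image _ _) ?_
    rintro z ⟨z', hz', h⟩
    exact (hfac z' z h).symm.trans hz'
  rw [this]
  exact hpat (Set.toFinite _).measurableSet

end Argmax

variable {n m : ℕ}

/-- The parameters `(c, r)` of the auctions with reserve prices in `R`, as a subtype of a Euclidean
space, from which it gets its Borel structure. -/
abbrev Param (R : Set (Fin m → ℝ)) : Type := {p : ℝ × (Fin m → ℝ) // 0 ≤ p.1 ∧ p.2 ∈ R}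

/-- The auction with given parameters. -/
def Param.auction {R : Set (Fin m → ℝ)} (p : Param R) : MBARP m := ⟨p.1.1, p.2.1, p.1.2⟩

/-- The affine functions of the parameters `(c, r)`, spanned by `1`, `c` and the `r k`. -/
noncomputable def affineSpace (R : Set (Fin m → ℝ)) : Submodule ℝ (Param R → ℝ) :=
  Submodule.span ℝ (Set.range fun j : Option (Option (Fin m)) => fun p : Param R =>
    j.elim 1 fun j => j.elim p.1.1 p.1.2)

variable {R : Set (Fin m → ℝ)}

instance : FiniteDimensional ℝ (affineSpace R) :=
  FiniteDimensional.span_of_finite ℝ (Set.finite_range _)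

theorem finrank_affineSpace_le : Module.finrank ℝ (affineSpace R) ≤ m + 2 := by
  refine (finrank_range_le_card _).trans ?_
  simp

theorem const_mem_affineSpace (a : ℝ) : (fun _ => a) ∈ affineSpace R := by
  have h : (fun _ => 1) ∈ affineSpace R := Submodule.subset_span ⟨none, rfl⟩
  convert (affineSpace R).smul_mem a h using 1
  ext p
  simp

theorem c_mem_affineSpace : (fun p : Param R => p.auction.c) ∈ affineSpace R :=
  Submodule.subset_span ⟨some none, rfl⟩

theorem r_mem_affineSpace (k : Fin m) : (fun p : Param R => p.auction.r k) ∈ affineSpace R :=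
  Submodule.subset_span ⟨some (some k), rfl⟩

theorem agentValue_mem_affineSpace (v : Valuations n m) (j : Fin (n + 1)) (b : Finset (Fin m)) :
    (fun p : Param R => agentValue p.auction v j b) ∈ affineSpace R := by
  cases j using Fin.cases with
  | zero =>
    have h := (affineSpace R).sum_mem fun k (_ : k ∈ b) => r_mem_affineSpace k
    convert h using 1
    ext p
    simp [agentValue]
  | succ i => exact const_mem_affineSpace (v i b)

theorem boost_mem_affineSpace (o : Allocation n m) :
    (fun p : Param R => boost p.auction o) ∈ affineSpace R := by
  unfold boost
  split_ifs
  · exact c_mem_affineSpace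
  · exact const_mem_affineSpace 0

theorem sum_agentValue_add_boost_mem_affineSpace (v : Valuations n m) (s : Finset (Fin (n + 1)))
    (o : Allocation n m) :
    (fun p : Param R => ∑ j ∈ s, agentValue p.auction v j (bundle o j) + boost p.auction o) ∈
      affineSpace R := by
  have h := (affineSpace R).add_mem ((affineSpace R).sum_mem fun j (_ : j ∈ s) =>
    agentValue_mem_affineSpace v j (bundle o j)) (boost_mem_affineSpace o)
  convert h using 1
  ext p
  simp

theorem welfare_mem_affineSpace (v : Valuations n m) (o : Allocation n m) :
    (fun p : Param R => welfare p.auction v o) ∈ affineSpace R :=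
  sum_agentValue_add_boost_mem_affineSpace v _ o

theorem welfareWithout_mem_affineSpace (v : Valuations n m) (i : Fin n) (o : Allocation n m) :
    (fun p : Param R => welfareWithout p.auction v i o) ∈ affineSpace R :=
  sum_agentValue_add_boost_mem_affineSpace v _ o

theorem measurable_agentValue (j : Fin (n + 1)) (b : Finset (Fin m)) :
    Measurable fun q : Param R × Valuations n m => agentValue q.1.auction q.2 j b := by
  cases j using Fin.cases with
  | zero =>
    have h : ∀ k, Measurable fun q : Param R × Valuations n m => q.1.auction.r k := fun k =>
      (measurable_pi_apply k).comp (measurable_snd.comp (measurable_subtype_coe.comp measurable_fst))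
    simp only [agentValue, Fin.cases_zero]
    fun_prop
  | succ i =>
    exact (measurable_pi_apply b).comp ((measurable_pi_apply i).comp measurable_snd)

theorem measurable_boost (o : Allocation n m) :
    Measurable fun q : Param R × Valuations n m => boost q.1.auction o := by
  unfold boost
  split_ifs
  · exact measurable_fst.comp (measurable_subtype_coe.comp measurable_fst)
  · exact measurable_const

theorem measurable_sum_agentValue_add_boost (s : Finset (Fin (n + 1))) (o : Allocation n m) :
    Measurable fun q : Param R × Valuations n m =>
      ∑ j ∈ s, agentValue q.1.auction q.2 j (bundle o j) + boost q.1.auction o :=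
  (Finset.measurable_fun_sum _ fun j _ => measurable_agentValue j _).add (measurable_boost o)

theorem measurable_revenue (e : Fin ((n + 1) ^ m) ≃ Allocation n m) :
    Measurable (Function.uncurry fun (p : Param R) (v : Valuations n m) =>
      revenue e p.auction v) := by
  have hW : ∀ o : Allocation n m, Measurable fun q : Param R × Valuations n m =>
      welfare q.1.auction q.2 o := fun o => measurable_sum_agentValue_add_boost _ o
  have hWi : ∀ i, ∀ o : Allocation n m, Measurable fun q : Param R × Valuations n m =>
      welfareWithout q.1.auction q.2 i o := fun i o => measurable_sum_agentValue_add_boost _ o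
  have hcomp : ∀ i (a : Param R × Valuations n m → Allocation n m), Measurable a →
      Measurable fun q : Param R × Valuations n m => welfareWithout q.1.auction q.2 i (a q) := by
    intro i a ha
    have h : Measurable fun w : (Param R × Valuations n m) × Allocation n m =>
        welfareWithout w.1.1.auction w.1.2 i w.2 := measurable_from_prod_countable_left (hWi i)
    have h' : Measurable fun q : Param R × Valuations n m => (q, a q) := measurable_id.prodMk ha
    have h3 := h.comp h'
    simp only [Function.comp_def] at h3
    exact h3
  have ha : Measurable fun q : Param R × Valuations n m => allocation e q.1.auction q.2 := by
    unfold allocation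
    exact measurable_argmax e hW
  have hai : ∀ i, Measurable fun q : Param R × Valuations n m =>
      allocationWithout e q.1.auction q.2 i := by
    intro i
    unfold allocationWithout
    exact measurable_argmax e (hWi i)
  unfold Function.uncurry revenue payment
  exact Finset.measurable_fun_sum _ fun i _ => (hcomp i _ (hai i)).sub (hcomp i _ ha)

/-- The differences of (boosted) welfare between two allocations whose signs determine all choices
of the auction on `v`. All agents are counted for the index `none`; bidder `i` is left out for
`some i`. -/
noncomputable def comparison (R : Set (Fin m → ℝ)) (v : Valuations n m) :
    Option (Fin n) × Allocation n m × Allocation n m → Param R → ℝ := fun q p =>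
  q.1.elim (welfare p.auction v q.2.1 - welfare p.auction v q.2.2) fun i =>
    welfareWithout p.auction v i q.2.1 - welfareWithout p.auction v i q.2.2

theorem comparison_mem_affineSpace (v : Valuations n m)
    (q : Option (Fin n) × Allocation n m × Allocation n m) :
    comparison R v q ∈ affineSpace R := by
  obtain ⟨_ | i, o, o'⟩ := q
  · exact (affineSpace R).sub_mem (welfare_mem_affineSpace v o) (welfare_mem_affineSpace v o')
  · exact (affineSpace R).sub_mem (welfareWithout_mem_affineSpace v i o)
      (welfareWithout_mem_affineSpace v i o')

/-- Once the chosen allocations are fixed, the revenue is affine in the parameters. -/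
theorem exists_affine_eq_revenue (e : Fin ((n + 1) ^ m) ≃ Allocation n m) (v : Valuations n m)
    (p₀ : Param R) : ∃ h ∈ affineSpace R, ∀ p,
      signPattern (comparison R v) p = signPattern (comparison R v) p₀ →
        revenue e p.auction v = h p := by
  refine ⟨∑ i : Fin n, ((fun p : Param R =>
      welfareWithout p.auction v i (allocationWithout e p₀.auction v i)) -
      fun p : Param R => welfareWithout p.auction v i (allocation e p₀.auction v)),
    (affineSpace R).sum_mem fun i _ => (affineSpace R).sub_mem
      (welfareWithout_mem_affineSpace v i _) (welfareWithout_mem_affineSpace v i _), fun p hp => ?_⟩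
  rw [signPattern_eq_iff] at hp
  have h1 : allocation e p.auction v = allocation e p₀.auction v := by
    unfold allocation
    exact argmax_congr e fun o o' => by simpa [comparison] using hp (none, o, o')
  have h2 : ∀ i, allocationWithout e p.auction v i = allocationWithout e p₀.auction v i := by
    intro i
    unfold allocationWithout
    exact argmax_congr e fun o o' => by simpa [comparison] using hp (some i, o, o')
  simp [revenue, payment, h1, h2]

end CombAuction

/-! ### The sample size -/

section SampleSize

open Real

/-- A constant for the sample complexity bound. Terms without a factor `log (U / ε)` are absorbed
through `log κ ≤ log (U / ε)`, hence the summand with `1 / log κ`. -/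
noncomputable def sampleConstant (κ : ℝ) : ℝ := 64 * (3500 / log κ + 30)

variable {κ x δ : ℝ} {n m N d : ℕ}

/-- What the sample size provides, for `x = U / ε`: enough for Chebyshev's inequality, and enough to
absorb the logarithm of the size of the net. -/
theorem le_of_sampleConstant_mul_le (hκ : 1 < κ) (hx : κ ≤ x) (hn : 2 ≤ n) (hm : 1 ≤ m)
    (hδ : δ ∈ Set.Ioo (0 : ℝ) 1)
    (hN : sampleConstant κ * (x ^ 2 * ((m : ℝ) ^ 3 * log n * log x + log (1 / δ))) ≤ N) :
    2 ≤ N / x ^ 2 ∧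
      3 + 72 * (m : ℝ) + 18 * m ^ 2 * log n + 15 * m * log x + 2304 * m ^ 2 + log (1 / δ) ≤
        N / x ^ 2 / 64 := by
  have hk : 0 < log κ := log_pos hκ
  have hx0 : 0 < x := by linarith
  have hy : log κ ≤ log x := log_le_log (by linarith) hx
  have hl : 0.69 ≤ log n := by
    have h2 : log 2 ≤ log n := log_le_log (by norm_num) (by exact_mod_cast hn)
    linarith [log_two_gt_d9]
  have hm' : (1 : ℝ) ≤ m := by exact_mod_cast hm
  have hL : 0 ≤ log (1 / δ) := log_nonneg (by rw [le_div_iff₀ hδ.1]; linarith [hδ.2])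
  set k := log κ
  set y := log x
  set l := log (n : ℝ)
  set L := log (1 / δ)
  have hy0 : 0 ≤ y := hk.le.trans hy
  set T := (m : ℝ) ^ 3 * l * y with hT
  set a := T / k with ha
  have hm23 : (m : ℝ) ^ 2 ≤ m ^ 3 := pow_le_pow_right₀ hm' (by norm_num)
  have hm13 : (m : ℝ) ≤ m ^ 3 := le_self_pow₀ hm' (by norm_num)
  have h1 : 0.69 * (m : ℝ) ^ 2 ≤ a := by
    rw [ha, le_div_iff₀ hk, hT, mul_comm (0.69 : ℝ)]
    gcongr
  have h2 : (m : ℝ) ^ 2 * l ≤ a := by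
    rw [ha, le_div_iff₀ hk, hT]
    gcongr
  have h3 : 0.69 * (m * y) ≤ T := by
    calc 0.69 * (m * y) = m * 0.69 * y := by ring
      _ ≤ T := by rw [hT]; gcongr
  have hm2 : (m : ℝ) ≤ m ^ 2 := le_self_pow₀ hm' (by norm_num)
  have hM : 64 * (3500 * a + 30 * T + 30 * L) ≤ N / x ^ 2 := by
    rw [le_div_iff₀ (by positivity)]
    refine le_trans ?_ hN
    have : sampleConstant κ * (x ^ 2 * (T + L)) =
        64 * (3500 * a + 30 * T + 30 * L) * x ^ 2 + 64 * (3500 / k * L) * x ^ 2 := by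
      rw [sampleConstant, ha]
      ring
    rw [this]
    have : 0 ≤ 64 * (3500 / k * L) * x ^ 2 := by positivity
    linarith
  have hTnn : 0 ≤ T := le_trans (by positivity) h3
  constructor <;> nlinarith

theorem log_le_div_add {M c : ℝ} (hM : 0 < M) (hc : 0 < c) : log M ≤ M / c + c := by
  have h1 := log_le_sub_one_of_pos (div_pos hM hc)
  have h2 := log_le_sub_one_of_pos hc
  rw [log_div hM.ne' hc.ne'] at h1
  linarith

/-- With enough samples, the union bound over the net is at most `δ`. The bases of the two powers
count sign patterns of comparisons and of threshold tests. -/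
theorem union_bound_le_of_sampleConstant_mul_le (hκ : 1 < κ) (hx : κ ≤ x) (hn : 2 ≤ n) (hm : 1 ≤ m)
    (hδ : δ ∈ Set.Ioo (0 : ℝ) 1) (hd : d ≤ m + 2)
    (hN : sampleConstant κ * (x ^ 2 * ((m : ℝ) ^ 3 * log n * log x + log (1 / δ))) ≤ N) :
    2 * (((N * 2 * ((n + 1) * ((n + 1) ^ m * (n + 1) ^ m)) + 1 : ℕ) : ℝ) ^ d *
      ((N * 2 * (⌈8 * x⌉₊ + 1) + 1 : ℕ) : ℝ) ^ d * (2 * exp (-(N / x ^ 2 / 32)))) ≤ δ := by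
  obtain ⟨hM2, hM⟩ := le_of_sampleConstant_mul_le hκ hx hn hm hδ hN
  have hx1 : 1 < x := by linarith
  have hx0 : 0 < x := by linarith
  have hm' : (1 : ℝ) ≤ m := by exact_mod_cast hm
  have hn' : (2 : ℝ) ≤ n := by exact_mod_cast hn
  have hM0 : (0 : ℝ) < N / x ^ 2 := by linarith
  have hN2 : 2 * x ^ 2 ≤ N := (le_div_iff₀ (by positivity)).1 hM2
  have hN1 : (1 : ℝ) ≤ N := by nlinarith
  have hlogN : log N = log (N / x ^ 2) + 2 * log x := by
    rw [log_div (by positivity) (by positivity), log_pow]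
    push_cast
    ring
  -- The choice `384 = 6 * 64` makes this use up half of the exponent `N / x ^ 2 / 32`.
  have hmlogM : 6 * m * log (N / x ^ 2) ≤ N / x ^ 2 / 64 + 2304 * m ^ 2 := by
    calc 6 * m * log (N / x ^ 2) ≤ 6 * m * (N / x ^ 2 / (384 * m) + 384 * m) := by
          gcongr
          exact log_le_div_add hM0 (by positivity)
      _ = _ := by field_simp; ring
  set p : ℝ := ((N * 2 * ((n + 1) * ((n + 1) ^ m * (n + 1) ^ m)) + 1 : ℕ) : ℝ) with hp
  set q : ℝ := ((N * 2 * (⌈8 * x⌉₊ + 1) + 1 : ℕ) : ℝ) with hq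
  have hp1 : 1 ≤ p := by rw [hp]; exact_mod_cast Nat.le_add_left _ _
  have hq1 : 1 ≤ q := by rw [hq]; exact_mod_cast Nat.le_add_left _ _
  have hlogp : log p ≤ 3 + log N + 6 * m * log n := by
    have hle : p ≤ 4 * N * (n : ℝ) ^ (6 * m) := by
      have h1 : ((n : ℝ) + 1) ≤ n ^ 2 := by nlinarith
      have h2 : ((n : ℝ) + 1) * ((n + 1) ^ m * (n + 1) ^ m) ≤ n ^ (6 * m) := by
        calc ((n : ℝ) + 1) * ((n + 1) ^ m * (n + 1) ^ m) = (n + 1) ^ (2 * m + 1) := by ring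
          _ ≤ (n ^ 2) ^ (2 * m + 1) := by gcongr
          _ = n ^ (2 * (2 * m + 1)) := by rw [← pow_mul]
          _ ≤ n ^ (6 * m) := pow_le_pow_right₀ (by linarith) (by omega)
      have h3 : (1 : ℝ) ≤ n ^ (6 * m) := one_le_pow₀ (by linarith)
      rw [hp]
      push_cast
      nlinarith
    have h4 : log 4 ≤ 3 := by linarith [log_le_sub_one_of_pos (show (0 : ℝ) < 4 by norm_num)]
    have h5 := log_le_log (by linarith) hle
    rw [log_mul (by positivity) (by positivity), log_mul (by norm_num) (by positivity), log_pow] at h5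
    push_cast at h5
    linarith
  have hlogq : log q ≤ 21 + log N + log x := by
    have hle : q ≤ 22 * N * x := by
      have h1 : (⌈8 * x⌉₊ : ℝ) < 8 * x + 1 := Nat.ceil_lt_add_one (by positivity)
      rw [hq]
      push_cast
      nlinarith
    have h4 : log 22 ≤ 21 := by linarith [log_le_sub_one_of_pos (show (0 : ℝ) < 22 by norm_num)]
    have h5 := log_le_log (by linarith) hle
    rw [log_mul (by positivity) (by positivity), log_mul (by norm_num) (by positivity)] at h5
    linarith
  have hd' : (d : ℝ) ≤ 3 * m := by
    have : d ≤ 3 * m := by omega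
    exact_mod_cast this
  have hlog : log 4 + d * (log p + log q) ≤ N / x ^ 2 / 32 - log (1 / δ) := by
    have h4 : log 4 ≤ 3 := by linarith [log_le_sub_one_of_pos (show (0 : ℝ) < 4 by norm_num)]
    have h5 : d * (log p + log q) ≤ 3 * m * (24 + 2 * log N + 6 * m * log n + log x) :=
      mul_le_mul hd' (by linarith) (add_nonneg (log_nonneg hp1) (log_nonneg hq1)) (by positivity)
    rw [hlogN] at h5
    nlinarith
  have hexp : 4 * (p ^ d * q ^ d) ≤ exp (N / x ^ 2 / 32) * δ := by
    have h1 : exp (log 4 + d * (log p + log q)) = 4 * (p ^ d * q ^ d) := by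
      rw [exp_add, exp_log (by norm_num), exp_nat_mul, exp_add, exp_log (by linarith),
        exp_log (by linarith), mul_pow]
    have h2 : exp (N / x ^ 2 / 32 - log (1 / δ)) = exp (N / x ^ 2 / 32) * δ := by
      rw [one_div, log_inv, sub_neg_eq_add, exp_add, exp_log hδ.1]
    rw [← h1, ← h2]
    exact exp_le_exp.2 hlog
  calc 2 * (p ^ d * q ^ d * (2 * exp (-(N / x ^ 2 / 32))))
      = 4 * (p ^ d * q ^ d) * exp (-(N / x ^ 2 / 32)) := by ring
    _ ≤ exp (N / x ^ 2 / 32) * δ * exp (-(N / x ^ 2 / 32)) := by gcongr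
    _ = δ := by rw [exp_neg]; field_simp

end SampleSize

theorem theorem2 (κ : ℝ) (hκ : 1 < κ) :
    ∃ C : ℝ, 0 < C ∧
      ∀ (n m : ℕ), 2 ≤ n → 1 ≤ m →
      ∀ (e : Fin ((n + 1) ^ m) ≃ CombAuction.Allocation n m)
        (R : Set (Fin m → ℝ)), MeasurableSet R →
      ∀ (X : Set (CombAuction.Valuations n m)) (U : ℝ),
        (∀ rev ∈ CombAuction.revenueClass e R, ∀ v ∈ X, rev v ∈ Set.Icc 0 U) →
      ∀ ε ∈ Set.Ioo (0 : ℝ) 1, ∀ δ ∈ Set.Ioo (0 : ℝ) 1, κ * ε ≤ U →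
        UniformConvergenceAt X (CombAuction.revenueClass e R) ε δ
          (C * ((U / ε) ^ 2 *
            ((m : ℝ) ^ 3 * Real.log n * Real.log (U / ε) + Real.log (1 / δ)))) := by
  have hk : 0 < Real.log κ := Real.log_pos hκ
  refine ⟨sampleConstant κ, by rw [sampleConstant]; positivity, ?_⟩
  intro n m hn hm e R hR X U hX ε hε δ hδ hκU N hN D hD hDX
  have hx : κ ≤ U / ε := (le_div_iff₀ hε.1).2 hκU
  have hU : 0 < U := lt_of_lt_of_le (mul_pos (by linarith) hε.1) hκU
  have hε0 := hε.1
  obtain ⟨hM2, -⟩ := le_of_sampleConstant_mul_le hκ hx hn hm hδ hN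
  have hNU : 2 * U ^ 2 ≤ N * ε ^ 2 := by
    rw [le_div_iff₀ (by positivity), div_pow, ← mul_div_assoc, div_le_iff₀ (by positivity)] at hM2
    exact hM2
  have hN0 : 0 < N := by
    rcases Nat.eq_zero_or_pos N with rfl | h
    · norm_num at hM2
    · exact h
  have hΘ : MeasurableSet {p : ℝ × (Fin m → ℝ) | 0 ≤ p.1 ∧ p.2 ∈ R} :=
    (measurableSet_le measurable_const measurable_fst).inter (measurable_snd hR)
  have : StandardBorelSpace (CombAuction.Param R) := hΘ.standardBorel
  have key := measure_deviation_le_of_piecewise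
    (fun (p : CombAuction.Param R) v => CombAuction.revenue e p.auction v)
    (CombAuction.measurable_revenue e) (CombAuction.affineSpace R)
    (CombAuction.const_mem_affineSpace 1) (CombAuction.comparison R)
    CombAuction.comparison_mem_affineSpace (CombAuction.exists_affine_eq_revenue e) hU
    (fun p v hv => hX _ ⟨p.auction, p.2.2, rfl⟩ v hv) hε0 hN0 hNU D hDX
  refine (measure_mono ?_).trans (key.trans ?_)
  · rintro S ⟨f, ⟨A, hA, rfl⟩, hS⟩
    exact ⟨⟨(A.c, A.r), A.c_nonneg, hA⟩, hS⟩
  · rw [← ENNReal.ofReal_ofNat, ← ENNReal.ofReal_mul (by norm_num)]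
    refine ENNReal.ofReal_le_ofReal ?_
    have h := union_bound_le_of_sampleConstant_mul_le hκ hx hn hm hδ
      (CombAuction.finrank_affineSpace_le (R := R)) hN
    have h1 : U / (ε / 8) = 8 * (U / ε) := by field_simp
    have h2 : (N * (ε / 4)) ^ 2 / (2 * N * U ^ 2) = N / (U / ε) ^ 2 / 32 := by
      field_simp
      ring
    rw [h1, h2]
    simpa using h
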